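/- Let $n\ge 0$ and let $G$ be a subgroup of the Pauli group on $n$ qubits, the gauge group of a subsystem code. Let $G'\subseteq G$ be a finite set of operators each of which is of X-type (a tensor product of factors $X$ and $I$) or of Z-type (a tensor product of factors $Z$ and $I$), and suppose that $G'$ generates $G$ up to phases in $\{\pm1,\pm i\}$. The stabilizers of the code are the elements of $S=G\cap\mathrm{Centralizer}(G)$ taken up to phases, where the phase of each stabilizer is fixed by writing it as a product $X(a)Z(b)$ of an X-type and a Z-type operator. A bare logical operator is a Pauli operator that commutes with every element of $G$, and the number $k$ of logical qubits is defined by the condition that the bare logical operators modulo stabilizers and phases form a group of order $4^k$. Let $H_p=-\sum_{g\in G'}g$ and let $\Pi_0$ be the orthogonal projector onto its ground space (the eigenspace of its lowest eigenvalue). Then: 1. every ground state $\psi$ of $H_p$ is stabilized by the stabilizers of the code: $s\psi=\psi$ for every stabilizer $s$; 2. the number $k$ of logical qubits is well defined (the above order is indeed a power of $4$), and the ground space of $H_p$ has dimension exactly $2^k$; 3. for every $g\in G$ there is a scalar $c$ with $\Pi_0\,g\,\Pi_0=c\,\Pi_0$. -/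

import Mathlib

open scoped Matrix

noncomputable section

namespace SubsystemCode

/-- Bit strings of length `n`: they label the computational basis of `n` qubits. -/
abbrev Bits (n : ℕ) : Type := Fin n → ZMod 2

/-- The Hilbert space of `n` qubits. -/
abbrev Qubits (n : ℕ) : Type := EuclideanSpace ℂ (Bits n)

/-- Invertible operators on `n` qubits, written as matrices in the computational basis. -/
abbrev Ops (n : ℕ) : Type := (Matrix (Bits n) (Bits n) ℂ)ˣ

variable {n : ℕ}

/-- The matrix of `X(a) = ⨂ᵢ Xᵢ^(aᵢ)`, that is `X(a)|y⟩ = |y + a⟩`. -/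
def xMatrix (a : Bits n) : Matrix (Bits n) (Bits n) ℂ :=
  Matrix.of fun x y => if x = y + a then 1 else 0

/-- The matrix of `Z(b) = ⨂ᵢ Zᵢ^(bᵢ)`, that is `Z(b)|x⟩ = (-1)^(b·x)|x⟩`. -/
def zMatrix (b : Bits n) : Matrix (Bits n) (Bits n) ℂ :=
  Matrix.diagonal fun x => (-1 : ℂ) ^ (b ⬝ᵥ x).val

theorem xMatrix_mul_self (a : Bits n) : xMatrix a * xMatrix a = 1 := by
  have h2 : ∀ y : Bits n, y + a + a = y := fun y => by
    funext i
    simp [add_assoc, CharTwo.add_self_eq_zero]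
  ext x y
  rw [Matrix.mul_apply, Finset.sum_eq_single (y + a)]
  · simp [xMatrix, h2, Matrix.one_apply]
  · intro z _ hz
    simp [xMatrix, hz]
  · simp

theorem zMatrix_mul_self (b : Bits n) : zMatrix b * zMatrix b = 1 := by
  rw [zMatrix, Matrix.diagonal_mul_diagonal, ← Matrix.diagonal_one]
  congr 1
  funext x
  rw [← mul_pow]
  simp

/-- `X(a)` as an invertible operator. -/
def xOp (a : Bits n) : Ops n := ⟨xMatrix a, xMatrix a, xMatrix_mul_self a, xMatrix_mul_self a⟩

/-- `Z(b)` as an invertible operator. -/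
def zOp (b : Bits n) : Ops n := ⟨zMatrix b, zMatrix b, zMatrix_mul_self b, zMatrix_mul_self b⟩

/-- An operator is of X-type if it is a tensor product of factors `X` and `I`. -/
def IsXType (g : Ops n) : Prop := ∃ a : Bits n, g = xOp a

/-- An operator is of Z-type if it is a tensor product of factors `Z` and `I`. -/
def IsZType (g : Ops n) : Prop := ∃ b : Bits n, g = zOp b

/-- The group of phases `{1, i, -1, -i}`. -/
def phases (n : ℕ) : Subgroup (Ops n) :=
  Subgroup.zpowers (Units.map (algebraMap ℂ (Matrix (Bits n) (Bits n) ℂ)).toMonoidHom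
    (Units.mk0 Complex.I Complex.I_ne_zero))

/-- The Pauli group on `n` qubits. -/
def pauliGroup (n : ℕ) : Subgroup (Ops n) :=
  Subgroup.closure (Set.range xOp ∪ Set.range zOp) ⊔ phases n

/-- `G ∩ Centralizer(G)`, with all phases adjoined. -/
def stabilizersWithPhases (G : Subgroup (Ops n)) : Subgroup (Ops n) :=
  (G ⊓ Subgroup.centralizer (G : Set (Ops n))) ⊔ phases n

/-- The stabilizers of the code with gauge group `G`: the elements of `G ∩ Centralizer(G)` up to
phases. Every Pauli operator is a phase times exactly one `X(a) Z(b)`, and the phase of a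
stabilizer is fixed by taking this product as the representative. (Without fixing phases,
`G ∩ Centralizer(G)` contains `-1` whenever `G` is not abelian.) -/
def stabilizers (G : Subgroup (Ops n)) : Set (Ops n) :=
  {s | s ∈ stabilizersWithPhases G ∧ ∃ a b : Bits n, s = xOp a * zOp b}

/-- The bare logical operators: the Pauli operators that commute with the gauge group. -/
def bareLogicals (G : Subgroup (Ops n)) : Subgroup (Ops n) :=
  pauliGroup n ⊓ Subgroup.centralizer (G : Set (Ops n))

/-- The code with gauge group `G` has `k` logical qubits: the bare logical operators modulo
stabilizers and phases form a group of order `4 ^ k`, the order of the Pauli group on `k` qubits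
modulo phases. -/
def HasLogicalQubits (G : Subgroup (Ops n)) (k : ℕ) : Prop :=
  (stabilizersWithPhases G).relIndex (bareLogicals G) = 4 ^ k

/-- The action of a matrix on the Hilbert space. -/
def toOperator (M : Matrix (Bits n) (Bits n) ℂ) : Qubits n →L[ℂ] Qubits n :=
  Matrix.toEuclideanCLM (n := Bits n) (𝕜 := ℂ) M

/-- The penalty Hamiltonian `H_p = -∑ g`, the sum being over a finite set of operators. -/
def penaltyHamiltonian (G' : Finset (Ops n)) : Qubits n →L[ℂ] Qubits n :=
  -∑ g ∈ G', toOperator (g : Matrix (Bits n) (Bits n) ℂ)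

/-- The ground energy of `H`: its least real eigenvalue. -/
def groundEnergy (H : Qubits n →L[ℂ] Qubits n) : ℝ :=
  sInf {E : ℝ | Module.End.HasEigenvalue (H : Qubits n →ₗ[ℂ] Qubits n) (E : ℂ)}

/-- The ground space of `H`: the eigenspace of the ground energy. -/
def groundSpace (H : Qubits n →L[ℂ] Qubits n) : Submodule ℂ (Qubits n) :=
  Module.End.eigenspace (H : Qubits n →ₗ[ℂ] Qubits n) (groundEnergy H : ℂ)

/-- The orthogonal projector `Π₀` onto the ground space of `H`. -/
def groundProjector (H : Qubits n →L[ℂ] Qubits n) : Qubits n →L[ℂ] Qubits n :=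
  (groundSpace H).starProjection

end SubsystemCode

end

open scoped Matrix

noncomputable section

namespace SubsystemCode

variable {n : ℕ}

/-! ### Variational characterization of the ground space -/

section Rayleigh

variable {H : Qubits n →L[ℂ] Qubits n}

/-! Let `A`, `B` be the F₂-spans of the X-labels and the Z-labels of `G'`. Up to phases, `G`
consists of the X(a)Z(b) with (a, b) in A × B, the bare logical operators correspond to B^⊥ × A^⊥,
and the stabilizers to (A ∩ B^⊥) × (B ∩ A^⊥).

In the computational basis the X-terms of H_p have nonpositive entries and the Z-terms are diagonal,
so a Perron–Frobenius argument applies: the entrywise absolute value of a ground state is a ground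
state (`absState_mem_groundSpace`), whence a ground state vanishing at x vanishes on the coset x + A
(`apply_add_eq_zero`). A ground state is thus determined by one value per coset. This forces
X-stabilizers to act trivially (`xShift_eq_self`); the Hadamard transform, which swaps X and Z,
gives the same for Z-stabilizers (`zPhase_eq_self`).

The Z-stabilizers confine ground states to (B ∩ A^⊥)^⊥ = B^⊥ + A, whose cosets of A are indexed by
B^⊥/(A ∩ B^⊥). Shifts by B^⊥ are symmetries of H_p and carry one ground state supported on A to each
such coset, giving an orthogonal basis (`finrank_groundSpace`). For (a, b) in A × B, X(a)Z(b)
preserves these cosets and commutes with these shifts, so its compression is scalar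
(`exists_scalar_inner`). Finally B^⊥/(A ∩ B^⊥) and A^⊥/(B ∩ A^⊥) have the same dimension k, because
the pairing of A and B has one rank; hence the order 2^k · 2^k = 4^k (`hasLogicalQubits`). -/

theorem rayleigh_eigenvector {E : ℝ} {f : Qubits n} (hf : H f = (E : ℂ) • f) :
    RCLike.re (inner ℂ (H f) f) = E * ‖f‖ ^ 2 := by
  rw [hf, inner_smul_left, inner_self_eq_norm_sq_to_K]
  simp [← Complex.ofReal_pow]

theorem bddBelow_rayleigh (H : Qubits n →L[ℂ] Qubits n) :
    BddBelow (Set.range fun x : {x : Qubits n // x ≠ 0} =>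
      RCLike.re (inner ℂ (H x) (x : Qubits n)) / ‖(x : Qubits n)‖ ^ 2) := by
  refine ⟨-‖H‖, ?_⟩
  rintro _ ⟨⟨x, hx⟩, rfl⟩
  have hx' : 0 < ‖x‖ := norm_pos_iff.2 hx
  have h1 : |RCLike.re (inner ℂ (H x) x)| ≤ ‖H‖ * ‖x‖ ^ 2 := by
    refine (RCLike.abs_re_le_norm _).trans ((norm_inner_le_norm _ _).trans ?_)
    rw [pow_two, ← mul_assoc]
    gcongr
    exact H.le_opNorm x
  show -‖H‖ ≤ _ / ‖x‖ ^ 2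
  rw [le_div_iff₀ (by positivity)]
  linarith [(abs_le.1 h1).1]

/-- In finite dimension the infimum of the Rayleigh quotient is an eigenvalue, and every eigenvalue
is a value of the quotient. So the `sInf` defining the ground energy is an attained minimum, not a
default value. -/
theorem groundEnergy_eq_iInf (hH : (H : Qubits n →ₗ[ℂ] Qubits n).IsSymmetric) :
    groundEnergy H = ⨅ x : {x : Qubits n // x ≠ 0},
      RCLike.re (inner ℂ (H x) (x : Qubits n)) / ‖(x : Qubits n)‖ ^ 2 := by
  refine IsLeast.csInf_eq ⟨hH.hasEigenvalue_iInf_of_finiteDimensional, ?_⟩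
  rintro E hE
  obtain ⟨f, hf⟩ := hE.exists_hasEigenvector
  have h := rayleigh_eigenvector (H := H) (E := E) hf.apply_eq_smul
  refine (ciInf_le (bddBelow_rayleigh H) ⟨f, hf.2⟩).trans_eq ?_
  have : 0 < ‖f‖ := norm_pos_iff.2 hf.2
  rw [h]
  field_simp

theorem groundEnergy_mul_le (hH : (H : Qubits n →ₗ[ℂ] Qubits n).IsSymmetric) (f : Qubits n) :
    groundEnergy H * ‖f‖ ^ 2 ≤ RCLike.re (inner ℂ (H f) f) := by
  by_cases hf : f = 0
  · simp [hf]
  have : 0 < ‖f‖ := norm_pos_iff.2 hf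
  rw [← le_div_iff₀ (by positivity), groundEnergy_eq_iInf hH]
  exact ciInf_le (bddBelow_rayleigh H) ⟨f, hf⟩

theorem exists_mem_groundSpace_ne_zero (hH : (H : Qubits n →ₗ[ℂ] Qubits n).IsSymmetric) :
    ∃ f ∈ groundSpace H, f ≠ 0 := by
  have h := hH.hasEigenvalue_iInf_of_finiteDimensional
  obtain ⟨f, hf⟩ := h.exists_hasEigenvector
  refine ⟨f, ?_, hf.2⟩
  rw [groundSpace, groundEnergy_eq_iInf hH]
  exact hf.1

theorem mem_groundSpace_iff {f : Qubits n} :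
    f ∈ groundSpace H ↔ H f = (groundEnergy H : ℂ) • f := by
  rw [groundSpace, Module.End.mem_eigenspace_iff]
  rfl

/-- A minimizer of the quadratic form on a sphere is a critical point, hence an eigenvector whose
eigenvalue is its Rayleigh quotient. This allows ground states to be recognized by energy alone. -/
theorem mem_groundSpace_of_le (hH : (H : Qubits n →ₗ[ℂ] Qubits n).IsSymmetric) {f : Qubits n}
    (hf : RCLike.re (inner ℂ (H f) f) ≤ groundEnergy H * ‖f‖ ^ 2) : f ∈ groundSpace H := by
  by_cases h0 : f = 0
  · simp [h0]
  have hpos : 0 < ‖f‖ := norm_pos_iff.2 h0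
  have heq := le_antisymm hf (groundEnergy_mul_le hH f)
  have hsa : IsSelfAdjoint H := (ContinuousLinearMap.isSelfAdjoint_iff_isSymmetric).2 hH
  have := hsa.eq_smul_self_of_isLocalExtrOn (x₀ := f) (Or.inl (IsMinOn.localize ?_))
  · rw [mem_groundSpace_iff, this]
    have hq : H.rayleighQuotient f = groundEnergy H := by
      rw [ContinuousLinearMap.rayleighQuotient, ContinuousLinearMap.reApplyInnerSelf_apply, heq,
        mul_div_cancel_right₀ _ (by positivity)]
    rw [hq]
    rfl
  · intro g hg
    have hg' : ‖g‖ = ‖f‖ := by simpa using hg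
    simp only [Set.mem_ofPred_eq, ContinuousLinearMap.reApplyInnerSelf_apply, heq]
    rw [← hg']
    exact groundEnergy_mul_le hH g

theorem map_mem_groundSpace_of_commute {T : Qubits n →L[ℂ] Qubits n} (hT : ∀ f, H (T f) = T (H f))
    {f : Qubits n} (hf : f ∈ groundSpace H) : T f ∈ groundSpace H := by
  rw [mem_groundSpace_iff] at hf ⊢
  rw [hT, hf, map_smul]

end Rayleigh

/-! ### Action of X(a), Z(b) and the Hamiltonian on states -/

/-- The sign `(-1)^t`. -/
def sgn (t : ZMod 2) : ℝ := (-1) ^ t.val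

@[simp] theorem sgn_zero : sgn 0 = 1 := by simp [sgn]

@[simp] theorem sgn_one : sgn 1 = -1 := by simp [sgn, ZMod.val_one]

theorem eq_zero_or_eq_one (t : ZMod 2) : t = 0 ∨ t = 1 := by
  fin_cases t
  · exact Or.inl rfl
  · exact Or.inr rfl

theorem sgn_add (s t : ZMod 2) : sgn (s + t) = sgn s * sgn t := by
  rcases eq_zero_or_eq_one s with rfl | rfl <;> rcases eq_zero_or_eq_one t with rfl | rfl <;>
    simp [CharTwo.add_self_eq_zero]

theorem sgn_mul_self (t : ZMod 2) : sgn t * sgn t = 1 := by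
  rw [← sgn_add, CharTwo.add_self_eq_zero, sgn_zero]

@[simp] theorem Bits.add_self (a : Bits n) : a + a = 0 := by
  funext i
  exact CharTwo.add_self_eq_zero _

@[simp] theorem Bits.add_add_self (x a : Bits n) : x + a + a = x := by
  rw [add_assoc, Bits.add_self, add_zero]

theorem Bits.neg_eq (a : Bits n) : -a = a := neg_eq_of_add_eq_zero_left (Bits.add_self a)

theorem Bits.eq_add_iff {x y a : Bits n} : x = y + a ↔ y = x + a := by
  constructor <;> rintro rfl <;> simp

/-- The operator `X(a)` on states. -/
def xShift (a : Bits n) : Qubits n →L[ℂ] Qubits n := toOperator (xMatrix a)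

/-- The operator `Z(b)` on states. -/
def zPhase (b : Bits n) : Qubits n →L[ℂ] Qubits n := toOperator (zMatrix b)

@[simp] theorem xShift_apply (a : Bits n) (f : Qubits n) (x : Bits n) :
    xShift a f x = f (x + a) := by
  show (xMatrix a *ᵥ f.ofLp) x = _
  simp only [Matrix.mulVec, dotProduct, xMatrix, Matrix.of_apply, Bits.eq_add_iff (x := x)]
  simp

@[simp] theorem zPhase_apply (b : Bits n) (f : Qubits n) (x : Bits n) :
    zPhase b f x = sgn (b ⬝ᵥ x) * f x := by
  show (zMatrix b *ᵥ f.ofLp) x = _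
  simp [zMatrix, Matrix.mulVec_diagonal, sgn]

theorem toOperator_mul_apply (M N : Matrix (Bits n) (Bits n) ℂ) (f : Qubits n) :
    toOperator (M * N) f = toOperator M (toOperator N f) := by
  rw [toOperator, map_mul]
  rfl

theorem xShift_xShift (a b : Bits n) (f : Qubits n) : xShift a (xShift b f) = xShift (a + b) f := by
  ext x
  simp [add_assoc]

@[simp] theorem xShift_self (a : Bits n) (f : Qubits n) : xShift a (xShift a f) = f := by
  ext x
  simp

@[simp] theorem xShift_zero (f : Qubits n) : xShift 0 f = f := by
  ext x
  simp

theorem inner_xShift (a : Bits n) (f g : Qubits n) :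
    inner ℂ (xShift a f) g = inner ℂ f (xShift a g) := by
  rw [PiLp.inner_apply, PiLp.inner_apply]
  refine Fintype.sum_equiv (Equiv.addRight a) _ _ fun x => ?_
  simp

theorem inner_zPhase (b : Bits n) (f g : Qubits n) :
    inner ℂ (zPhase b f) g = inner ℂ f (zPhase b g) := by
  rw [PiLp.inner_apply, PiLp.inner_apply]
  refine Finset.sum_congr rfl fun x _ => ?_
  simp
  ring

/-- The Hamiltonian `-∑ X(a) - ∑ Z(b)`. -/
def cssHam (SX SZ : Finset (Bits n)) : Qubits n →L[ℂ] Qubits n :=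
  -(∑ a ∈ SX, xShift a + ∑ b ∈ SZ, zPhase b)

theorem cssHam_apply (SX SZ : Finset (Bits n)) (f : Qubits n) :
    cssHam SX SZ f = -(∑ a ∈ SX, xShift a f + ∑ b ∈ SZ, zPhase b f) := by
  simp [cssHam]

theorem cssHam_apply_apply (SX SZ : Finset (Bits n)) (f : Qubits n) (x : Bits n) :
    cssHam SX SZ f x =
      -(∑ a ∈ SX, f (x + a) + ∑ b ∈ SZ, (sgn (b ⬝ᵥ x) : ℂ) * f x) := by
  simp [cssHam_apply]

theorem cssHam_isSymmetric (SX SZ : Finset (Bits n)) :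
    (cssHam SX SZ : Qubits n →ₗ[ℂ] Qubits n).IsSymmetric := by
  intro f g
  simp only [ContinuousLinearMap.coe_coe, cssHam_apply, inner_neg_left, inner_neg_right,
    inner_add_left, inner_add_right, sum_inner, inner_sum, inner_xShift, inner_zPhase]

/-! ### Hadamard duality between X and Z -/

/-- The Hadamard transform, without normalization. -/
def hadamard (n : ℕ) : Qubits n →ₗ[ℂ] Qubits n where
  toFun f := WithLp.toLp 2 fun x => ∑ y, (sgn (x ⬝ᵥ y) : ℂ) * f y
  map_add' f g := by
    ext x
    simp [mul_add, Finset.sum_add_distrib]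
  map_smul' c f := by
    ext x
    simp only [PiLp.smul_apply, smul_eq_mul, RingHom.id_apply, Finset.mul_sum]
    exact Finset.sum_congr rfl fun y _ => by ring

theorem hadamard_apply (f : Qubits n) (x : Bits n) :
    hadamard n f x = ∑ y, (sgn (x ⬝ᵥ y) : ℂ) * f y := rfl

theorem hadamard_xShift (a : Bits n) (f : Qubits n) :
    hadamard n (xShift a f) = zPhase a (hadamard n f) := by
  ext x
  rw [zPhase_apply, hadamard_apply, hadamard_apply, Finset.mul_sum]
  refine Fintype.sum_equiv (Equiv.addRight a) _ _ fun y => ?_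
  have h := sgn_mul_self (a ⬝ᵥ x)
  simp only [xShift_apply, Equiv.coe_addRight, dotProduct_add, sgn_add, dotProduct_comm x a]
  rw [Complex.ofReal_mul, show ∀ p q r : ℂ, p * (q * p * r) = (p * p) * (q * r) by intros; ring,
    ← Complex.ofReal_mul, h, Complex.ofReal_one, one_mul]

theorem hadamard_zPhase (b : Bits n) (f : Qubits n) :
    hadamard n (zPhase b f) = xShift b (hadamard n f) := by
  ext x
  rw [xShift_apply, hadamard_apply, hadamard_apply]
  refine Finset.sum_congr rfl fun y _ => ?_
  rw [zPhase_apply, add_dotProduct, sgn_add, Complex.ofReal_mul, mul_assoc]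

theorem sum_sgn_dotProduct {y : Bits n} (hy : y ≠ 0) : ∑ x : Bits n, sgn (x ⬝ᵥ y) = 0 := by
  obtain ⟨i, hi⟩ := Function.ne_iff.1 hy
  have hi1 : y i = 1 := (eq_zero_or_eq_one _).resolve_left hi
  have : ∑ x : Bits n, sgn (x ⬝ᵥ y) = ∑ x : Bits n, -sgn (x ⬝ᵥ y) := by
    -- Flipping a bit where `y` is 1 reverses every sign.
    refine Fintype.sum_equiv (Equiv.addRight (Pi.single i 1)) _ _ fun x => ?_
    simp [add_dotProduct, sgn_add, hi1]
  rw [Finset.sum_neg_distrib] at this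
  linarith

theorem hadamard_hadamard (f : Qubits n) :
    hadamard n (hadamard n f) = (Fintype.card (Bits n) : ℂ) • f := by
  ext x
  simp only [hadamard_apply, Finset.mul_sum, PiLp.smul_apply, smul_eq_mul]
  rw [Finset.sum_comm, Finset.sum_eq_single x]
  · simp_rw [← mul_assoc, ← Complex.ofReal_mul, dotProduct_comm x, sgn_mul_self]
    simp
  · intro z _ hz
    have hz' : x + z ≠ 0 := fun h => hz (by rw [← Bits.add_add_self z x, add_comm z x, h, zero_add])
    have := sum_sgn_dotProduct hz'
    simp_rw [← mul_assoc, ← Finset.sum_mul, ← Complex.ofReal_mul, dotProduct_comm x, ← sgn_add,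
      ← dotProduct_add, ← Complex.ofReal_sum, this]
    simp
  · simp

theorem hadamard_injective : Function.Injective (hadamard n) := by
  intro f g h
  have := congrArg (hadamard n) h
  rw [hadamard_hadamard, hadamard_hadamard] at this
  exact smul_right_injective _ (Nat.cast_ne_zero.2 Fintype.card_ne_zero) this

theorem hadamard_cssHam (SX SZ : Finset (Bits n)) (f : Qubits n) :
    hadamard n (cssHam SX SZ f) = cssHam SZ SX (hadamard n f) := by
  simp only [cssHam_apply, map_neg, map_add, map_sum, hadamard_xShift, hadamard_zPhase]
  rw [add_comm]

theorem hasEigenvalue_cssHam_swap {SX SZ : Finset (Bits n)} {μ : ℂ}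
    (h : Module.End.HasEigenvalue (cssHam SX SZ : Qubits n →ₗ[ℂ] Qubits n) μ) :
    Module.End.HasEigenvalue (cssHam SZ SX : Qubits n →ₗ[ℂ] Qubits n) μ := by
  obtain ⟨f, hf⟩ := h.exists_hasEigenvector
  refine Module.End.hasEigenvalue_of_hasEigenvector (x := hadamard n f) ⟨?_, ?_⟩
  · have h1 : cssHam SX SZ f = μ • f := hf.apply_eq_smul
    rw [Module.End.mem_eigenspace_iff, ContinuousLinearMap.coe_coe, ← hadamard_cssHam, h1, map_smul]
  · exact fun h0 => hf.2 (hadamard_injective (h0.trans (map_zero _).symm))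

theorem groundEnergy_cssHam_swap (SX SZ : Finset (Bits n)) :
    groundEnergy (cssHam SX SZ) = groundEnergy (cssHam SZ SX) := by
  rw [groundEnergy, groundEnergy]
  congr 1
  ext E
  exact ⟨hasEigenvalue_cssHam_swap, hasEigenvalue_cssHam_swap⟩

theorem hadamard_mem_groundSpace {SX SZ : Finset (Bits n)} {f : Qubits n}
    (hf : f ∈ groundSpace (cssHam SX SZ)) : hadamard n f ∈ groundSpace (cssHam SZ SX) := by
  rw [mem_groundSpace_iff] at hf ⊢
  rw [← hadamard_cssHam, hf, map_smul, groundEnergy_cssHam_swap]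

/-! ### Perron–Frobenius argument -/

/-- The state of entrywise absolute values. -/
def absState (f : Qubits n) : Qubits n := WithLp.toLp 2 fun x => (‖f x‖ : ℂ)

@[simp] theorem absState_apply (f : Qubits n) (x : Bits n) : absState f x = (‖f x‖ : ℂ) := rfl

theorem norm_absState (f : Qubits n) : ‖absState f‖ = ‖f‖ := by
  simp [EuclideanSpace.norm_eq]

/-- Triangle inequality: X(a) has nonnegative entries. With the minus sign in H_p, taking absolute
values cannot raise the energy. -/
theorem re_inner_xShift_le (a : Bits n) (f : Qubits n) :
    RCLike.re (inner ℂ (xShift a f) f) ≤ RCLike.re (inner ℂ (xShift a (absState f)) (absState f)) := by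
  simp only [PiLp.inner_apply, map_sum]
  refine Finset.sum_le_sum fun x _ => ?_
  refine (RCLike.re_le_norm _).trans_eq ?_
  simp [← Complex.ofReal_mul]

theorem re_inner_zPhase_absState (b : Bits n) (f : Qubits n) :
    RCLike.re (inner ℂ (zPhase b (absState f)) (absState f)) =
      RCLike.re (inner ℂ (zPhase b f) f) := by
  simp only [PiLp.inner_apply, map_sum]
  refine Finset.sum_congr rfl fun x _ => ?_
  simp only [zPhase_apply, absState_apply, RCLike.inner_apply, map_mul, Complex.conj_ofReal]
  have h : f x * (sgn (b ⬝ᵥ x) * (starRingEnd ℂ) (f x)) = sgn (b ⬝ᵥ x) * (‖f x‖ * ‖f x‖) := by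
    rw [mul_left_comm, Complex.mul_conj, Complex.normSq_eq_norm_sq]
    push_cast
    ring
  rw [h]
  congr 1
  ring

theorem absState_mem_groundSpace {SX SZ : Finset (Bits n)} {f : Qubits n}
    (hf : f ∈ groundSpace (cssHam SX SZ)) : absState f ∈ groundSpace (cssHam SX SZ) := by
  refine mem_groundSpace_of_le (cssHam_isSymmetric SX SZ) ?_
  rw [norm_absState, ← rayleigh_eigenvector (mem_groundSpace_iff.1 hf)]
  simp only [cssHam_apply, inner_neg_left, inner_add_left, sum_inner, map_neg, map_add, map_sum,
    re_inner_zPhase_absState]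
  have := Finset.sum_le_sum fun a (_ : a ∈ SX) => re_inner_xShift_le a f
  linarith

/-- In the eigenvalue equation of |f| at `x` all terms proportional to |f x| drop out, leaving a
vanishing sum of the nonnegative numbers |f (x + a)|. -/
theorem apply_add_eq_zero_of_mem {SX SZ : Finset (Bits n)} {f : Qubits n}
    (hf : f ∈ groundSpace (cssHam SX SZ)) {x a : Bits n} (hx : f x = 0) (ha : a ∈ SX) :
    f (x + a) = 0 := by
  have h := congrArg (fun g : Qubits n => g x) (mem_groundSpace_iff.1 (absState_mem_groundSpace hf))
  simp only [cssHam_apply_apply, absState_apply, PiLp.smul_apply, hx, norm_zero,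
    Complex.ofReal_zero, mul_zero, smul_zero, Finset.sum_const_zero, add_zero, neg_eq_zero,
    ← Complex.ofReal_sum, Complex.ofReal_eq_zero] at h
  rw [Finset.sum_eq_zero_iff_of_nonneg (fun _ _ => norm_nonneg _)] at h
  exact norm_eq_zero.1 (h a ha)

theorem apply_add_eq_zero {SX SZ : Finset (Bits n)} {f : Qubits n}
    (hf : f ∈ groundSpace (cssHam SX SZ)) {x a : Bits n} (hx : f x = 0)
    (ha : a ∈ Submodule.span (ZMod 2) (SX : Set (Bits n))) : f (x + a) = 0 := by
  induction ha using Submodule.span_induction generalizing x with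
  | mem a ha => exact apply_add_eq_zero_of_mem hf hx ha
  | zero => simpa using hx
  | add a b _ _ iha ihb => rw [← add_assoc]; exact ihb (iha hx)
  | smul c a _ ih =>
    rcases eq_zero_or_eq_one c with rfl | rfl
    · simpa using hx
    · simpa using ih hx

/-! ### Stabilizers act trivially on ground states -/

/-- The annihilator of a set of bit strings under the dot product. -/
def perp (A : Submodule (ZMod 2) (Bits n)) : Submodule (ZMod 2) (Bits n) where
  carrier := {b | ∀ a ∈ A, a ⬝ᵥ b = 0}
  add_mem' hb hc a ha := by rw [dotProduct_add, hb a ha, hc a ha, add_zero]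
  zero_mem' a _ := dotProduct_zero a
  smul_mem' c b hb a ha := by rw [dotProduct_smul, hb a ha, smul_zero]

theorem mem_perp {A : Submodule (ZMod 2) (Bits n)} {b : Bits n} :
    b ∈ perp A ↔ ∀ a ∈ A, a ⬝ᵥ b = 0 := Iff.rfl

theorem mem_perp_span {S : Set (Bits n)} {b : Bits n} :
    b ∈ perp (Submodule.span (ZMod 2) S) ↔ ∀ a ∈ S, a ⬝ᵥ b = 0 := by
  refine ⟨fun h a ha => h a (Submodule.subset_span ha), fun h a ha => ?_⟩
  induction ha using Submodule.span_induction with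
  | mem a ha => exact h a ha
  | zero => simp
  | add a b _ _ iha ihb => rw [add_dotProduct, iha, ihb, add_zero]
  | smul c a _ ih => rw [smul_dotProduct, ih, smul_zero]

theorem xShift_zPhase_comm {a b : Bits n} (h : b ⬝ᵥ a = 0) (f : Qubits n) :
    xShift a (zPhase b f) = zPhase b (xShift a f) := by
  ext x
  simp [dotProduct_add, h]

theorem cssHam_xShift {SX SZ : Finset (Bits n)} {a : Bits n}
    (ha : a ∈ perp (Submodule.span (ZMod 2) (SZ : Set (Bits n)))) (f : Qubits n) :
    cssHam SX SZ (xShift a f) = xShift a (cssHam SX SZ f) := by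
  rw [mem_perp_span] at ha
  simp only [cssHam_apply, map_neg, map_add, map_sum]
  congr 2
  · exact Finset.sum_congr rfl fun c _ => by rw [xShift_xShift, xShift_xShift, add_comm]
  · exact Finset.sum_congr rfl fun b hb => (xShift_zPhase_comm (ha b hb) f).symm

theorem xShift_mem_groundSpace {SX SZ : Finset (Bits n)} {a : Bits n}
    (ha : a ∈ perp (Submodule.span (ZMod 2) (SZ : Set (Bits n)))) {f : Qubits n}
    (hf : f ∈ groundSpace (cssHam SX SZ)) : xShift a f ∈ groundSpace (cssHam SX SZ) :=
  map_mem_groundSpace_of_commute (cssHam_xShift ha) hf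

/-- The difference D = f - X(a)f is a ground state odd under the shift by `a`, while zeros of ground
states propagate along `A`; comparing D with |D| shows that D vanishes. -/
theorem xShift_eq_self {SX SZ : Finset (Bits n)} {a : Bits n}
    (ha : a ∈ Submodule.span (ZMod 2) (SX : Set (Bits n)))
    (ha' : a ∈ perp (Submodule.span (ZMod 2) (SZ : Set (Bits n)))) {f : Qubits n}
    (hf : f ∈ groundSpace (cssHam SX SZ)) : xShift a f = f := by
  set D := f - xShift a f with hD
  have hDg : D ∈ groundSpace (cssHam SX SZ) := Submodule.sub_mem _ hf (xShift_mem_groundSpace ha' hf)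
  have hanti : ∀ x, D (x + a) = -D x := fun x => by simp [hD]
  suffices D = 0 from (sub_eq_zero.1 this).symm
  ext x
  by_contra hx
  have hx' : D x ≠ 0 := hx
  have hn : (‖D x‖ : ℂ) ≠ 0 := Complex.ofReal_ne_zero.2 (norm_ne_zero_iff.2 hx')
  -- The phase of D x is chosen so that this ground state vanishes at `x`; at `x + a` its value is
  -- -2 D x.
  have hE : D - (D x / ‖D x‖) • absState D ∈ groundSpace (cssHam SX SZ) :=
    Submodule.sub_mem _ hDg (Submodule.smul_mem _ _ (absState_mem_groundSpace hDg))
  have h0 : (D - (D x / ‖D x‖) • absState D) x = 0 := by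
    simp [div_mul_cancel₀ _ hn]
  have h1 := apply_add_eq_zero hE h0 ha
  simp only [PiLp.sub_apply, PiLp.smul_apply, absState_apply, hanti, norm_neg, smul_eq_mul,
    div_mul_cancel₀ _ hn] at h1
  apply hx'
  linear_combination -h1 / 2

theorem zPhase_eq_self {SX SZ : Finset (Bits n)} {b : Bits n}
    (hb : b ∈ Submodule.span (ZMod 2) (SZ : Set (Bits n)))
    (hb' : b ∈ perp (Submodule.span (ZMod 2) (SX : Set (Bits n)))) {f : Qubits n}
    (hf : f ∈ groundSpace (cssHam SX SZ)) : zPhase b f = f := by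
  apply hadamard_injective
  rw [hadamard_zPhase]
  exact xShift_eq_self hb hb' (hadamard_mem_groundSpace hf)

/-! ### Duality for the dot product over F₂ -/

theorem perp_eq_orthogonal (A : Submodule (ZMod 2) (Bits n)) :
    perp A = LinearMap.BilinForm.orthogonal (dotProductBilin (ZMod 2) (ZMod 2)) A := by
  ext b
  rfl

theorem dotProductBilin_nondegenerate :
    LinearMap.BilinForm.Nondegenerate
      (dotProductBilin (ZMod 2) (ZMod 2) : LinearMap.BilinForm (ZMod 2) (Bits n)) := by
  constructor
  · intro x hx
    exact dotProduct_eq_zero x fun y => hx y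
  · intro x hx
    exact dotProduct_eq_zero x fun y => by rw [dotProduct_comm]; exact hx y

theorem dotProductBilin_isRefl :
    LinearMap.BilinForm.IsRefl
      (dotProductBilin (ZMod 2) (ZMod 2) : LinearMap.BilinForm (ZMod 2) (Bits n)) := by
  intro x y h
  exact (dotProduct_comm y x).trans h

theorem perp_perp (A : Submodule (ZMod 2) (Bits n)) : perp (perp A) = A := by
  rw [perp_eq_orthogonal, perp_eq_orthogonal]
  exact LinearMap.BilinForm.orthogonal_orthogonal dotProductBilin_nondegenerate
    dotProductBilin_isRefl A

theorem finrank_add_finrank_perp (A : Submodule (ZMod 2) (Bits n)) :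
    Module.finrank (ZMod 2) A + Module.finrank (ZMod 2) (perp A) = n := by
  have h : Module.finrank (ZMod 2) (perp A) = n - Module.finrank (ZMod 2) A := by
    rw [perp_eq_orthogonal]
    refine (LinearMap.BilinForm.finrank_orthogonal dotProductBilin_nondegenerate A).trans ?_
    rw [Module.finrank_fin_fun]
  have hle := A.finrank_le
  rw [Module.finrank_fin_fun] at hle
  omega

theorem perp_sup (A B : Submodule (ZMod 2) (Bits n)) : perp (A ⊔ B) = perp A ⊓ perp B := by
  ext b
  rw [Submodule.mem_inf]
  refine ⟨fun h => ⟨fun a ha => h a (Submodule.mem_sup_left ha),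
    fun a ha => h a (Submodule.mem_sup_right ha)⟩, fun h x hx => ?_⟩
  obtain ⟨y, hy, z, hz, rfl⟩ := Submodule.mem_sup.1 hx
  rw [add_dotProduct, h.1 y hy, h.2 z hz, add_zero]

theorem perp_inf_perp (A B : Submodule (ZMod 2) (Bits n)) : perp (B ⊓ perp A) = perp B ⊔ A := by
  rw [← perp_perp (perp B ⊔ A), perp_sup, perp_perp]

/-- The rank of the pairing of `A` and `B`, computed on either side. -/
theorem finrank_add_finrank_inf_perp (A B : Submodule (ZMod 2) (Bits n)) :
    Module.finrank (ZMod 2) A + Module.finrank (ZMod 2) ↥(B ⊓ perp A) =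
      Module.finrank (ZMod 2) B + Module.finrank (ZMod 2) ↥(A ⊓ perp B) := by
  have h1 := finrank_add_finrank_perp (B ⊓ perp A)
  have h2 := finrank_add_finrank_perp B
  have h3 := Submodule.finrank_sup_add_finrank_inf_eq (perp B) A
  rw [perp_inf_perp] at h1
  rw [inf_comm (perp B)] at h3
  omega

@[simp] theorem zPhase_zero (f : Qubits n) : zPhase 0 f = f := by
  ext x
  simp

/-! ### Orthogonal basis of the ground space -/

/-- The index set of the ground states: bit strings annihilated by `B`, modulo `A`. -/
abbrev Sectors (A B : Submodule (ZMod 2) (Bits n)) : Type := perp B ⧸ A.submoduleOf (perp B)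

/-- A representative of a sector. -/
def Sectors.rep {A B : Submodule (ZMod 2) (Bits n)} (q : Sectors A B) : Bits n :=
  (Quotient.out q : perp B)

theorem Sectors.rep_mem {A B : Submodule (ZMod 2) (Bits n)} (q : Sectors A B) : q.rep ∈ perp B :=
  (Quotient.out q : perp B).2

theorem Sectors.eq_of_rep_add_mem {A B : Submodule (ZMod 2) (Bits n)} {q r : Sectors A B}
    (h : q.rep + r.rep ∈ A) : q = r := by
  rw [← Quotient.out_eq q, ← Quotient.out_eq r]
  refine (Submodule.Quotient.eq _).2 ?_
  show (Quotient.out q : perp B).1 - (Quotient.out r : perp B).1 ∈ A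
  rw [sub_eq_add_neg, Bits.neg_eq]
  exact h

theorem Sectors.exists_rep_add_mem {A B : Submodule (ZMod 2) (Bits n)} {p : Bits n}
    (hp : p ∈ perp B) : ∃ q : Sectors A B, q.rep + p ∈ A := by
  refine ⟨Submodule.Quotient.mk ⟨p, hp⟩, ?_⟩
  have h : (Submodule.Quotient.mk (Quotient.out (Submodule.Quotient.mk ⟨p, hp⟩ : Sectors A B)) :
      Sectors A B) = Submodule.Quotient.mk ⟨p, hp⟩ := Quotient.out_eq _
  have h2 := (Submodule.Quotient.eq _).1 h
  have h3 : Sectors.rep (Submodule.Quotient.mk ⟨p, hp⟩ : Sectors A B) - p ∈ A := h2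
  rwa [sub_eq_add_neg, Bits.neg_eq] at h3

section GroundSpace

variable {SX SZ : Finset (Bits n)} {A B : Submodule (ZMod 2) (Bits n)}

/-- Where f x ≠ 0, the relation Z(b)f = f for b in B ∩ A^⊥ forces b·x = 0. -/
theorem mem_sup_of_apply_ne_zero (hA : A = Submodule.span (ZMod 2) (SX : Set (Bits n)))
    (hB : B = Submodule.span (ZMod 2) (SZ : Set (Bits n))) {f : Qubits n}
    (hf : f ∈ groundSpace (cssHam SX SZ)) {x : Bits n} (hx : f x ≠ 0) : x ∈ perp B ⊔ A := by
  subst hA hB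
  rw [← perp_inf_perp]
  intro b hb
  have h := congrArg (fun g : Qubits n => g x) (zPhase_eq_self hb.1 hb.2 hf)
  rcases eq_zero_or_eq_one (b ⬝ᵥ x) with h0 | h1
  · exact h0
  · simp only [zPhase_apply, h1, sgn_one] at h
    refine absurd ?_ hx
    push_cast at h
    linear_combination -h / 2

-- A shift by B^⊥ brings a nonzero value into `A`; the part outside `A` may then be cut off, since
-- H_p does not couple different cosets of `A`.
open scoped Classical in
theorem exists_groundState_supported (hA : A = Submodule.span (ZMod 2) (SX : Set (Bits n)))
    (hB : B = Submodule.span (ZMod 2) (SZ : Set (Bits n))) :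
    ∃ φ ∈ groundSpace (cssHam SX SZ), φ 0 ≠ 0 ∧ ∀ x ∉ A, φ x = 0 := by
  obtain ⟨ψ, hψ, hψ0⟩ := exists_mem_groundSpace_ne_zero (cssHam_isSymmetric SX SZ)
  obtain ⟨x, hx⟩ : ∃ x, ψ x ≠ 0 := by
    by_contra! h
    exact hψ0 (by ext x; exact h x)
  obtain ⟨p, hp, a, ha, rfl⟩ := Submodule.mem_sup.1 (mem_sup_of_apply_ne_zero hA hB hψ hx)
  have hχ : xShift p ψ ∈ groundSpace (cssHam SX SZ) := xShift_mem_groundSpace (hB ▸ hp) hψ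
  -- A zero at 0 would propagate to `a`, where the shifted state takes the value ψ (p + a).
  have hχ0 : xShift p ψ 0 ≠ 0 := by
    intro h
    have := apply_add_eq_zero hχ h (hA ▸ ha)
    rw [xShift_apply, zero_add, add_comm] at this
    exact hx this
  generalize xShift p ψ = χ at hχ hχ0
  refine ⟨WithLp.toLp 2 fun x => if x ∈ A then χ x else 0, ?_, ?_, fun x hx => if_neg hx⟩
  · rw [mem_groundSpace_iff] at hχ ⊢
    ext x
    have h := congrArg (fun g : Qubits n => g x) hχ
    have hmem : ∀ a ∈ SX, (x + a ∈ A ↔ x ∈ A) := fun a ha =>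
      A.add_mem_iff_left (hA ▸ Submodule.subset_span ha)
    simp only [cssHam_apply_apply, PiLp.smul_apply] at h ⊢
    rw [Finset.sum_congr rfl fun a ha => by rw [if_congr (hmem a ha) rfl rfl]]
    by_cases hx : x ∈ A
    · simpa only [if_pos hx] using h
    · simp only [if_neg hx]
      simp
  · simpa using hχ0

variable {φ : Qubits n}

/-- Distinct sectors have disjoint supports, preserved by X(a)Z(b); within a sector the shift by its
representative is an isometry commuting with X(a)Z(b). -/
theorem inner_sector_states (hφ : ∀ x ∉ A, φ x = 0) {a b : Bits n} (ha : a ∈ A) (hb : b ∈ B)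
    [DecidableEq (Sectors A B)] (q r : Sectors A B) :
    inner ℂ (xShift q.rep φ) (xShift a (zPhase b (xShift r.rep φ))) =
      if q = r then inner ℂ φ (xShift a (zPhase b φ)) else 0 := by
  split_ifs with h
  · subst h
    rw [← xShift_zPhase_comm (q.rep_mem b hb), xShift_xShift, add_comm a, ← xShift_xShift,
      ← inner_xShift, xShift_self]
  · rw [PiLp.inner_apply]
    refine Finset.sum_eq_zero fun x _ => ?_
    simp only [xShift_apply, zPhase_apply]
    by_cases h1 : x + q.rep ∈ A
    · by_cases h2 : x + a + r.rep ∈ A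
      · refine absurd (Sectors.eq_of_rep_add_mem ?_) h
        have h3 := A.add_mem (A.add_mem h1 h2) ha
        have h4 : x + q.rep + (x + a + r.rep) + a = (x + x) + (a + a) + (q.rep + r.rep) := by abel
        rwa [h4, Bits.add_self, Bits.add_self, zero_add, zero_add] at h3
      · rw [hφ _ h2]
        simp
    · rw [hφ _ h1]
      simp

theorem inner_sector_states' (hφ : ∀ x ∉ A, φ x = 0)
    [DecidableEq (Sectors A B)] (q r : Sectors A B) :
    inner ℂ (xShift q.rep φ) (xShift r.rep φ) = if q = r then inner ℂ φ φ else 0 := by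
  simpa using inner_sector_states hφ A.zero_mem B.zero_mem q r

theorem sector_state_mem (hB : B = Submodule.span (ZMod 2) (SZ : Set (Bits n)))
    (hφg : φ ∈ groundSpace (cssHam SX SZ)) (q : Sectors A B) :
    xShift q.rep φ ∈ groundSpace (cssHam SX SZ) :=
  xShift_mem_groundSpace (hB ▸ q.rep_mem) hφg

/-- The difference of the two sides is a ground state vanishing at every representative, hence on
every coset that ground states can occupy. -/
theorem groundState_eq_sum [Fintype (Sectors A B)]
    (hA : A = Submodule.span (ZMod 2) (SX : Set (Bits n)))
    (hB : B = Submodule.span (ZMod 2) (SZ : Set (Bits n)))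
    (hφg : φ ∈ groundSpace (cssHam SX SZ)) (hφ0 : φ 0 ≠ 0) (hφ : ∀ x ∉ A, φ x = 0)
    {f : Qubits n} (hf : f ∈ groundSpace (cssHam SX SZ)) :
    f = ∑ q : Sectors A B, (f q.rep / φ 0) • xShift q.rep φ := by
  classical
  set D := f - ∑ q : Sectors A B, (f q.rep / φ 0) • xShift q.rep φ with hD
  have hDg : D ∈ groundSpace (cssHam SX SZ) :=
    Submodule.sub_mem _ hf (Submodule.sum_mem _ fun q _ =>
      Submodule.smul_mem _ _ (sector_state_mem hB hφg q))
  suffices D = 0 from sub_eq_zero.1 this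
  have hrep : ∀ q : Sectors A B, D q.rep = 0 := by
    intro q
    simp only [hD, PiLp.sub_apply, WithLp.ofLp_sum, Finset.sum_apply, PiLp.smul_apply,
      xShift_apply, smul_eq_mul]
    rw [Finset.sum_eq_single q]
    · simp [div_mul_cancel₀ _ hφ0]
    · intro r _ hr
      rw [hφ _ fun h => hr (Sectors.eq_of_rep_add_mem h).symm, mul_zero]
    · simp
  ext x
  by_contra hx
  obtain ⟨p, hp, a, ha, rfl⟩ := Submodule.mem_sup.1 (mem_sup_of_apply_ne_zero hA hB hDg hx)
  obtain ⟨q, hq⟩ := Sectors.exists_rep_add_mem (A := A) hp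
  have hqa : q.rep + p + a ∈ Submodule.span (ZMod 2) (SX : Set (Bits n)) := hA ▸ A.add_mem hq ha
  have h2 := apply_add_eq_zero hDg (hrep q) hqa
  rw [← add_assoc, ← add_assoc, Bits.add_self, zero_add] at h2
  exact hx h2

theorem finrank_groundSpace (hA : A = Submodule.span (ZMod 2) (SX : Set (Bits n)))
    (hB : B = Submodule.span (ZMod 2) (SZ : Set (Bits n))) :
    Module.finrank ℂ (groundSpace (cssHam SX SZ)) = Nat.card (Sectors A B) := by
  classical
  have : Fintype (Sectors A B) := Fintype.ofFinite _
  obtain ⟨φ, hφg, hφ0, hφ⟩ := exists_groundState_supported hA hB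
  have hne : φ ≠ 0 := fun h => hφ0 (by rw [h]; rfl)
  have hspan : groundSpace (cssHam SX SZ) =
      Submodule.span ℂ (Set.range fun q : Sectors A B => xShift q.rep φ) := by
    refine le_antisymm (fun f hf => ?_) (Submodule.span_le.2 ?_)
    · rw [groundState_eq_sum hA hB hφg hφ0 hφ hf]
      exact Submodule.sum_mem _ fun q _ =>
        Submodule.smul_mem _ _ (Submodule.subset_span ⟨q, rfl⟩)
    · rintro _ ⟨q, rfl⟩
      exact sector_state_mem hB hφg q
  have hli : LinearIndependent ℂ fun q : Sectors A B => xShift q.rep φ := by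
    refine linearIndependent_of_ne_zero_of_inner_eq_zero (fun q h => hne ?_) fun q r hqr => ?_
    · rw [← xShift_self q.rep φ, h, map_zero]
    · exact (inner_sector_states' hφ q r).trans (if_neg hqr)
  rw [hspan, finrank_span_eq_card hli, Nat.card_eq_fintype_card]

theorem exists_scalar_inner (hA : A = Submodule.span (ZMod 2) (SX : Set (Bits n)))
    (hB : B = Submodule.span (ZMod 2) (SZ : Set (Bits n))) {a b : Bits n} (ha : a ∈ A)
    (hb : b ∈ B) : ∃ c : ℂ, ∀ f ∈ groundSpace (cssHam SX SZ), ∀ g ∈ groundSpace (cssHam SX SZ),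
      inner ℂ f (xShift a (zPhase b g)) = c * inner ℂ f g := by
  classical
  have : Fintype (Sectors A B) := Fintype.ofFinite _
  obtain ⟨φ, hφg, hφ0, hφ⟩ := exists_groundState_supported hA hB
  have hne : inner ℂ φ φ ≠ 0 := inner_self_ne_zero.2 fun h => hφ0 (by rw [h]; rfl)
  -- The scalar is the expectation value in φ, the same in every sector.
  refine ⟨inner ℂ φ (xShift a (zPhase b φ)) / inner ℂ φ φ, fun f hf g hg => ?_⟩
  rw [groundState_eq_sum hA hB hφg hφ0 hφ hf, groundState_eq_sum hA hB hφg hφ0 hφ hg]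
  simp only [map_sum, map_smul, sum_inner, inner_sum, inner_smul_left, inner_smul_right,
    inner_sector_states hφ ha hb, inner_sector_states' hφ, Finset.mul_sum]
  refine Finset.sum_congr rfl fun q _ => Finset.sum_congr rfl fun r _ => ?_
  split_ifs
  · field_simp
  · simp

end GroundSpace

theorem exists_scalar_projector {K : Submodule ℂ (Qubits n)} {T : Qubits n →L[ℂ] Qubits n} {c : ℂ}
    (h : ∀ f ∈ K, ∀ g ∈ K, inner ℂ f (T g) = c * inner ℂ f g) :
    K.starProjection ∘L T ∘L K.starProjection = c • K.starProjection := by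
  ext1 u
  refine ext_inner_left ℂ fun v => ?_
  have h1 := h _ (K.starProjection_apply_mem v) _ (K.starProjection_apply_mem u)
  simp only [ContinuousLinearMap.comp_apply, smul_apply, inner_smul_right]
  rw [← K.inner_starProjection_left_eq_right, h1, K.inner_starProjection_left_eq_right,
    Submodule.starProjection_eq_self_iff.2 (K.starProjection_apply_mem u)]

/-! ### Normal form of Pauli operators -/

theorem sgn_injective : Function.Injective sgn := by
  intro s t h
  rcases eq_zero_or_eq_one s with rfl | rfl <;> rcases eq_zero_or_eq_one t with rfl | rfl
  · rfl
  · norm_num at h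
  · norm_num at h
  · rfl

theorem toOperator_injective : Function.Injective (toOperator (n := n)) :=
  (Matrix.toEuclideanCLM (n := Bits n) (𝕜 := ℂ)).injective

theorem Ops.ext_apply {g h : Ops n}
    (H : ∀ f x, toOperator g.val f x = toOperator h.val f x) : g = h := by
  refine Units.ext (toOperator_injective ?_)
  ext f x
  exact H f x

theorem toOperator_mul (g h : Ops n) (f : Qubits n) :
    toOperator (g * h).val f = toOperator g.val (toOperator h.val f) :=
  toOperator_mul_apply _ _ f

theorem toOperator_xOp (a : Bits n) : toOperator (xOp a).val = xShift a := rfl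

theorem toOperator_zOp (b : Bits n) : toOperator (zOp b).val = zPhase b := rfl

theorem toOperator_one (f : Qubits n) : toOperator (1 : Ops n).val f = f := by
  rw [Units.val_one, toOperator, map_one]
  rfl

theorem xOp_zero : xOp (0 : Bits n) = 1 :=
  Ops.ext_apply fun f x => by rw [toOperator_xOp, toOperator_one, xShift_zero]

theorem zOp_zero : zOp (0 : Bits n) = 1 :=
  Ops.ext_apply fun f x => by rw [toOperator_zOp, toOperator_one, zPhase_zero]

theorem xOp_add (a b : Bits n) : xOp (a + b) = xOp a * xOp b :=
  Ops.ext_apply fun f x => by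
    rw [toOperator_mul]
    simp only [toOperator_xOp, xShift_xShift]

theorem zOp_add (a b : Bits n) : zOp (a + b) = zOp a * zOp b :=
  Ops.ext_apply fun f x => by
    rw [toOperator_mul]
    simp [toOperator_zOp, add_dotProduct, sgn_add, mul_assoc]

/-- Nonzero scalars as invertible operators. -/
def scalarOp (n : ℕ) : ℂˣ →* Ops n :=
  Units.map (algebraMap ℂ (Matrix (Bits n) (Bits n) ℂ)).toMonoidHom

/-- The imaginary unit as an invertible scalar. -/
def unitI : ℂˣ := Units.mk0 Complex.I Complex.I_ne_zero

theorem phases_eq : phases n = Subgroup.zpowers (scalarOp n unitI) := rfl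

theorem toOperator_scalarOp (c : ℂˣ) (f : Qubits n) :
    toOperator (scalarOp n c).val f = (c : ℂ) • f := by
  show Matrix.toEuclideanCLM (n := Bits n) (𝕜 := ℂ) (algebraMap ℂ _ (c : ℂ)) f = _
  rw [AlgHomClass.commutes, Algebra.algebraMap_eq_smul_one]
  rfl

theorem scalarOp_injective : Function.Injective (scalarOp n) :=
  Units.map_injective (algebraMap ℂ (Matrix (Bits n) (Bits n) ℂ)).injective

theorem scalarOp_commute (c : ℂˣ) (g : Ops n) : Commute (scalarOp n c) g :=
  Units.ext (Algebra.commutes (c : ℂ) g.val)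

theorem exists_scalarOp_eq {p : Ops n} (hp : p ∈ phases n) : ∃ c, p = scalarOp n c := by
  rw [phases_eq] at hp
  obtain ⟨k, rfl⟩ := Subgroup.mem_zpowers_iff.1 hp
  exact ⟨unitI ^ k, (map_zpow _ _ _).symm⟩

theorem commute_of_mem_phases {p : Ops n} (hp : p ∈ phases n) (g : Ops n) : Commute p g := by
  obtain ⟨c, rfl⟩ := exists_scalarOp_eq hp
  exact scalarOp_commute c g

theorem natCard_phases : Nat.card (phases n) = 4 := by
  rw [phases_eq, Nat.card_zpowers, orderOf_injective _ scalarOp_injective]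
  have : orderOf unitI = 2 ^ (1 + 1) := by
    refine orderOf_eq_prime_pow (fun h => ?_) ?_
    · have := congrArg Units.val h
      norm_num [unitI] at this
    · ext
      simp [unitI]
  exact this

theorem neg_one_mem_phases : scalarOp n (-1) ∈ phases n := by
  rw [phases_eq]
  refine Subgroup.mem_zpowers_iff.2 ⟨2, ?_⟩
  rw [← map_zpow]
  congr 1
  ext
  rw [zpow_ofNat]
  simp [unitI]

theorem commute_xOp_zOp {a b : Bits n} (h : b ⬝ᵥ a = 0) :
    Commute (xOp a) (zOp b) :=
  Ops.ext_apply fun f x => by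
    rw [toOperator_mul, toOperator_mul, toOperator_xOp, toOperator_zOp, xShift_zPhase_comm h]

theorem dotProduct_eq_zero_of_commute {a b : Bits n} (h : Commute (xOp a) (zOp b)) :
    b ⬝ᵥ a = 0 := by
  -- On the constant state, evaluated at 0, the two orders of the product give (-1)^(b·a) and 1.
  have h1 := congrArg (fun g : Ops n => toOperator g.val (WithLp.toLp 2 fun _ => 1) 0) h.eq
  simp only [toOperator_mul, toOperator_xOp, toOperator_zOp, xShift_apply, zPhase_apply] at h1
  refine (eq_zero_or_eq_one _).resolve_right fun h2 => ?_
  norm_num [h2] at h1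

theorem exists_phase_mul {a b : Bits n} :
    ∃ p ∈ phases n, zOp b * xOp a = p * (xOp a * zOp b) := by
  rcases eq_zero_or_eq_one (b ⬝ᵥ a) with h | h
  · exact ⟨1, one_mem _, by rw [one_mul, (commute_xOp_zOp h).eq]⟩
  · refine ⟨_, neg_one_mem_phases, Ops.ext_apply fun f x => ?_⟩
    simp only [toOperator_mul, toOperator_xOp, toOperator_zOp, toOperator_scalarOp,
      PiLp.smul_apply, xShift_apply, zPhase_apply, dotProduct_add, sgn_add, h]
    simp

theorem pauli_unique {c c' : ℂˣ} {a a' b b' : Bits n}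
    (h : scalarOp n c * (xOp a * zOp b) = scalarOp n c' * (xOp a' * zOp b')) :
    c = c' ∧ a = a' ∧ b = b' := by
  have H : ∀ (f : Qubits n) (x : Bits n), (c : ℂ) * (sgn (b ⬝ᵥ (x + a)) * f (x + a)) =
      c' * (sgn (b' ⬝ᵥ (x + a')) * f (x + a')) := by
    intro f x
    have := congrArg (fun g : Ops n => toOperator g.val f x) h
    simpa only [toOperator_mul, toOperator_xOp, toOperator_zOp, toOperator_scalarOp,
      PiLp.smul_apply, xShift_apply, zPhase_apply, smul_eq_mul] using this
  -- The basis state at 0 isolates the shift, and at this point the sign is 1, so the scalar can be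
  -- read off too.
  have h1 := H (EuclideanSpace.single 0 1) a
  have ha : a = a' := by
    by_contra hne
    have h0 : a + a' ≠ 0 := fun h0 => hne (by rw [← Bits.add_add_self a a', h0, zero_add])
    simp [h0] at h1
  subst ha
  have hc : c = c' := by
    ext
    simpa using h1
  subst hc
  refine ⟨rfl, rfl, ?_⟩
  rw [← sub_eq_zero]
  refine dotProduct_eq_zero _ fun y => ?_
  -- The constant state leaves only the signs at `y`.
  have h2 := H (WithLp.toLp 2 fun _ => 1) (y + a)
  simp only [Bits.add_add_self, mul_one, mul_eq_mul_left_iff, Units.ne_zero, or_false,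
    Complex.ofReal_inj] at h2
  rw [sub_dotProduct, sub_eq_zero]
  exact sgn_injective h2

theorem xOp_inj {a a' : Bits n} (h : xOp a = xOp a') : a = a' :=
  (pauli_unique (c := 1) (c' := 1) (b := 0) (b' := 0) (by rw [h])).2.1

theorem zOp_inj {b b' : Bits n} (h : zOp b = zOp b') : b = b' :=
  (pauli_unique (c := 1) (c' := 1) (a := 0) (a' := 0) (by rw [h])).2.2

theorem eq_zero_of_xOp_eq_zOp {a b : Bits n} (h : xOp a = zOp b) : b = 0 :=
  (pauli_unique (c := 1) (c' := 1) (a := a) (a' := 0) (b := 0) (b' := b)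
    (by rw [h, xOp_zero, zOp_zero, mul_one, one_mul])).2.2.symm

/-- The Pauli operators `p X(a) Z(b)` with `p` a phase, `a ∈ A` and `b ∈ B`. -/
def pauliSubgroup (A B : Submodule (ZMod 2) (Bits n)) : Subgroup (Ops n) where
  carrier := {g | ∃ p ∈ phases n, ∃ a ∈ A, ∃ b ∈ B, g = p * (xOp a * zOp b)}
  one_mem' := ⟨1, one_mem _, 0, A.zero_mem, 0, B.zero_mem, by simp [xOp_zero, zOp_zero]⟩
  mul_mem' := by
    rintro _ _ ⟨p, hp, a, ha, b, hb, rfl⟩ ⟨p', hp', a', ha', b', hb', rfl⟩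
    obtain ⟨s, hs, h⟩ := exists_phase_mul (a := a') (b := b)
    refine ⟨p * p' * s, mul_mem (mul_mem hp hp') hs, a + a', A.add_mem ha ha', b + b',
      B.add_mem hb hb', ?_⟩
    calc p * (xOp a * zOp b) * (p' * (xOp a' * zOp b'))
        = p * (xOp a * zOp b * p') * (xOp a' * zOp b') := by group
      _ = p * (p' * (xOp a * zOp b)) * (xOp a' * zOp b') := by
          rw [(commute_of_mem_phases hp' (xOp a * zOp b)).eq]
      _ = p * p' * xOp a * (zOp b * xOp a') * zOp b' := by group
      _ = p * p' * (xOp a * s) * (xOp a' * zOp b * zOp b') := by rw [h]; group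
      _ = p * p' * (s * xOp a) * (xOp a' * zOp b * zOp b') := by
          rw [(commute_of_mem_phases hs (xOp a)).eq]
      _ = p * p' * s * (xOp (a + a') * zOp (b + b')) := by rw [xOp_add, zOp_add]; group
  inv_mem' := by
    rintro _ ⟨p, hp, a, ha, b, hb, rfl⟩
    obtain ⟨s, hs, h⟩ := exists_phase_mul (a := a) (b := b)
    refine ⟨p⁻¹ * s, mul_mem (inv_mem hp) hs, a, ha, b, hb, ?_⟩
    have hx : (xOp a)⁻¹ = xOp a := rfl
    have hz : (zOp b)⁻¹ = zOp b := rfl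
    rw [mul_inv_rev, mul_inv_rev, hx, hz, h, ← (commute_of_mem_phases (inv_mem hp) _).eq, mul_assoc]

theorem mem_pauliSubgroup {A B : Submodule (ZMod 2) (Bits n)} {g : Ops n} :
    g ∈ pauliSubgroup A B ↔ ∃ p ∈ phases n, ∃ a ∈ A, ∃ b ∈ B, g = p * (xOp a * zOp b) := Iff.rfl

theorem phases_le_pauliSubgroup (A B : Submodule (ZMod 2) (Bits n)) :
    phases n ≤ pauliSubgroup A B := fun p hp =>
  ⟨p, hp, 0, A.zero_mem, 0, B.zero_mem, by simp [xOp_zero, zOp_zero]⟩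

theorem xOp_mem_pauliSubgroup {A : Submodule (ZMod 2) (Bits n)} (B : Submodule (ZMod 2) (Bits n))
    {a : Bits n} (ha : a ∈ A) : xOp a ∈ pauliSubgroup A B :=
  ⟨1, one_mem _, a, ha, 0, B.zero_mem, by simp [zOp_zero]⟩

theorem zOp_mem_pauliSubgroup (A : Submodule (ZMod 2) (Bits n)) {B : Submodule (ZMod 2) (Bits n)}
    {b : Bits n} (hb : b ∈ B) : zOp b ∈ pauliSubgroup A B :=
  ⟨1, one_mem _, 0, A.zero_mem, b, hb, by simp [xOp_zero]⟩

theorem pauliSubgroup_le {A B : Submodule (ZMod 2) (Bits n)} {K : Subgroup (Ops n)}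
    (hp : phases n ≤ K) (hx : ∀ a ∈ A, xOp a ∈ K) (hz : ∀ b ∈ B, zOp b ∈ K) :
    pauliSubgroup A B ≤ K := by
  rintro _ ⟨p, hp', a, ha, b, hb, rfl⟩
  exact mul_mem (hp hp') (mul_mem (hx a ha) (hz b hb))

theorem mem_of_mul_mem_pauliSubgroup {A B : Submodule (ZMod 2) (Bits n)} {p : Ops n} {a b : Bits n}
    (hp : p ∈ phases n) (h : p * (xOp a * zOp b) ∈ pauliSubgroup A B) : a ∈ A ∧ b ∈ B := by
  obtain ⟨p', hp', a', ha, b', hb, h'⟩ := h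
  obtain ⟨c, rfl⟩ := exists_scalarOp_eq hp
  obtain ⟨c', rfl⟩ := exists_scalarOp_eq hp'
  obtain ⟨-, rfl, rfl⟩ := pauli_unique h'
  exact ⟨ha, hb⟩

theorem pauliSubgroup_inf (A B C D : Submodule (ZMod 2) (Bits n)) :
    pauliSubgroup A B ⊓ pauliSubgroup C D = pauliSubgroup (A ⊓ C) (B ⊓ D) := by
  refine le_antisymm ?_ (pauliSubgroup_le
    (le_inf (phases_le_pauliSubgroup _ _) (phases_le_pauliSubgroup _ _))
    (fun a ha => ⟨xOp_mem_pauliSubgroup _ ha.1, xOp_mem_pauliSubgroup _ ha.2⟩)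
    (fun b hb => ⟨zOp_mem_pauliSubgroup _ hb.1, zOp_mem_pauliSubgroup _ hb.2⟩))
  rintro _ ⟨⟨p, hp, a, ha, b, hb, rfl⟩, h⟩
  have h' := mem_of_mul_mem_pauliSubgroup hp h
  exact ⟨p, hp, a, ⟨ha, h'.1⟩, b, ⟨hb, h'.2⟩, rfl⟩

theorem natCard_pauliSubgroup (A B : Submodule (ZMod 2) (Bits n)) :
    Nat.card (pauliSubgroup A B) =
      4 * 2 ^ (Module.finrank (ZMod 2) A + Module.finrank (ZMod 2) B) := by
  let e : phases n × A × B → pauliSubgroup A B := fun t =>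
    ⟨t.1 * (xOp t.2.1.1 * zOp t.2.2.1), t.1, t.1.2, t.2.1, t.2.1.2, t.2.2, t.2.2.2, rfl⟩
  have he : Function.Bijective e := by
    constructor
    · rintro ⟨⟨p, hp⟩, ⟨a, ha⟩, ⟨b, hb⟩⟩ ⟨⟨p', hp'⟩, ⟨a', ha'⟩, ⟨b', hb'⟩⟩ h
      have h' : p * (xOp a * zOp b) = p' * (xOp a' * zOp b') := congrArg Subtype.val h
      obtain ⟨c, rfl⟩ := exists_scalarOp_eq hp
      obtain ⟨c', rfl⟩ := exists_scalarOp_eq hp'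
      obtain ⟨rfl, rfl, rfl⟩ := pauli_unique h'
      rfl
    · rintro ⟨_, p, hp, a, ha, b, hb, rfl⟩
      exact ⟨⟨⟨p, hp⟩, ⟨a, ha⟩, ⟨b, hb⟩⟩, rfl⟩
  rw [← Nat.card_congr (Equiv.ofBijective e he), Nat.card_prod, Nat.card_prod, natCard_phases,
    Module.natCard_eq_pow_finrank (K := ZMod 2) (V := A),
    Module.natCard_eq_pow_finrank (K := ZMod 2) (V := B), Nat.card_zmod, pow_add]

theorem pauliGroup_eq : pauliGroup n = pauliSubgroup ⊤ ⊤ := by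
  refine le_antisymm (sup_le ((Subgroup.closure_le _).2 ?_) (phases_le_pauliSubgroup _ _))
    (pauliSubgroup_le le_sup_right (fun a _ => ?_) fun b _ => ?_)
  · rintro _ (⟨a, rfl⟩ | ⟨b, rfl⟩)
    · exact xOp_mem_pauliSubgroup _ trivial
    · exact zOp_mem_pauliSubgroup _ trivial
  · exact Subgroup.mem_sup_left (Subgroup.subset_closure (Or.inl ⟨a, rfl⟩))
  · exact Subgroup.mem_sup_left (Subgroup.subset_closure (Or.inr ⟨b, rfl⟩))

theorem commute_xOp (a a' : Bits n) : Commute (xOp a) (xOp a') := by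
  rw [Commute, SemiconjBy, ← xOp_add, add_comm, xOp_add]

theorem commute_zOp (b b' : Bits n) : Commute (zOp b) (zOp b') := by
  rw [Commute, SemiconjBy, ← zOp_add, add_comm, zOp_add]

theorem pauliSubgroup_le_centralizer (A B : Submodule (ZMod 2) (Bits n)) :
    pauliSubgroup (perp B) (perp A) ≤ Subgroup.centralizer (pauliSubgroup A B : Set (Ops n)) := by
  rintro _ ⟨p, hp, a, ha, b, hb, rfl⟩
  rw [Subgroup.mem_centralizer_iff]
  rintro _ ⟨p', hp', a', ha', b', hb', rfl⟩
  have h1 := commute_xOp_zOp (ha b' hb')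
  have h2 := commute_xOp_zOp ((dotProduct_comm b a').trans (hb a' ha'))
  exact ((commute_of_mem_phases hp' _).mul_left ((commute_of_mem_phases hp _).symm.mul_right
    (((commute_xOp a' a).mul_right h2).mul_left (h1.symm.mul_right (commute_zOp b' b))))).eq

/-! ### Bare logical operators, stabilizers and the count of logical qubits -/

section Gauge

variable {G : Subgroup (Ops n)} {A B : Submodule (ZMod 2) (Bits n)}

/-- Phases are central and Z's commute among themselves, so commuting with Z(b') constrains only the
X-part `a`; symmetrically, commuting with X(a') constrains only `b`. -/
theorem bareLogicals_eq (hG : G ≤ pauliSubgroup A B) (hA : ∀ a ∈ A, xOp a ∈ G)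
    (hB : ∀ b ∈ B, zOp b ∈ G) : bareLogicals G = pauliSubgroup (perp B) (perp A) := by
  rw [bareLogicals, pauliGroup_eq]
  refine le_antisymm ?_ (le_inf ?_ ?_)
  · rintro _ ⟨⟨p, hp, a, -, b, -, rfl⟩, hc⟩
    have hc' := Subgroup.mem_centralizer_iff.1 hc
    have key : ∀ g ∈ G, Commute (xOp a * zOp b) g := by
      intro g hg
      have h1 : Commute (p * (xOp a * zOp b)) g := (hc' g hg).symm
      have h2 := (commute_of_mem_phases (inv_mem hp) g).mul_left h1
      rwa [inv_mul_cancel_left] at h2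
    refine ⟨p, hp, a, fun b' hb' => dotProduct_eq_zero_of_commute ?_, b, fun a' ha' => ?_, rfl⟩
    · have h := (key _ (hB b' hb')).mul_left (commute_zOp b b').inv_left
      rwa [mul_inv_cancel_right] at h
    · rw [dotProduct_comm]
      have h := (commute_xOp a a').inv_left.mul_left (key _ (hA a' ha'))
      rw [inv_mul_cancel_left] at h
      exact dotProduct_eq_zero_of_commute h.symm
  · exact pauliSubgroup_le (phases_le_pauliSubgroup _ _)
      (fun a _ => xOp_mem_pauliSubgroup _ trivial) (fun b _ => zOp_mem_pauliSubgroup _ trivial)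
  · exact (pauliSubgroup_le_centralizer A B).trans (Subgroup.centralizer_le hG)

theorem stabilizersWithPhases_eq (hG : G ≤ pauliSubgroup A B) (hA : ∀ a ∈ A, xOp a ∈ G)
    (hB : ∀ b ∈ B, zOp b ∈ G) :
    stabilizersWithPhases G = pauliSubgroup (A ⊓ perp B) (B ⊓ perp A) := by
  have hL := bareLogicals_eq hG hA hB
  have hcent : pauliSubgroup (perp B) (perp A) ≤ Subgroup.centralizer (G : Set (Ops n)) :=
    hL ▸ inf_le_right
  refine le_antisymm (sup_le ?_ (phases_le_pauliSubgroup _ _)) ?_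
  · rw [← pauliSubgroup_inf, ← hL]
    refine le_inf (inf_le_left.trans hG) (le_inf (inf_le_left.trans (hG.trans ?_)) inf_le_right)
    rw [pauliGroup_eq]
    exact pauliSubgroup_le (phases_le_pauliSubgroup _ _)
      (fun a _ => xOp_mem_pauliSubgroup _ trivial) (fun b _ => zOp_mem_pauliSubgroup _ trivial)
  · exact pauliSubgroup_le le_sup_right
      (fun a ha => Subgroup.mem_sup_left
        ⟨hA a ha.1, hcent (xOp_mem_pauliSubgroup _ ha.2)⟩)
      (fun b hb => Subgroup.mem_sup_left
        ⟨hB b hb.1, hcent (zOp_mem_pauliSubgroup _ hb.2)⟩)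

theorem finrank_sectors (A B : Submodule (ZMod 2) (Bits n)) :
    Module.finrank (ZMod 2) (Sectors A B) + Module.finrank (ZMod 2) ↥(A ⊓ perp B) =
      Module.finrank (ZMod 2) (perp B) := by
  rw [← (A.submoduleOf (perp B)).finrank_quotient_add_finrank]
  congr 1
  rw [← Submodule.finrank_map_subtype_eq (perp B) (A.submoduleOf (perp B)), Submodule.submoduleOf,
    Submodule.map_comap_subtype, inf_comm]

theorem hasLogicalQubits (hG : G ≤ pauliSubgroup A B) (hA : ∀ a ∈ A, xOp a ∈ G)
    (hB : ∀ b ∈ B, zOp b ∈ G) :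
    HasLogicalQubits G (Module.finrank (ZMod 2) (Sectors A B)) := by
  rw [HasLogicalQubits, bareLogicals_eq hG hA hB, stabilizersWithPhases_eq hG hA hB]
  have hle : pauliSubgroup (A ⊓ perp B) (B ⊓ perp A) ≤ pauliSubgroup (perp B) (perp A) := by
    rw [← pauliSubgroup_inf]
    exact inf_le_right
  have h := Subgroup.relIndex_mul_relIndex ⊥ _ _ bot_le hle
  rw [Subgroup.relIndex_bot_left, Subgroup.relIndex_bot_left, natCard_pauliSubgroup,
    natCard_pauliSubgroup] at h
  have h1 := finrank_sectors A B
  have h2 := finrank_add_finrank_inf_perp A B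
  have h3 := finrank_add_finrank_perp A
  have h4 := finrank_add_finrank_perp B
  -- B^⊥/(A ∩ B^⊥) and A^⊥/(B ∩ A^⊥) each contribute k; for the second this uses the equality of
  -- ranks `h2`.
  have h5 : Module.finrank (ZMod 2) (perp B) + Module.finrank (ZMod 2) (perp A) =
      Module.finrank (ZMod 2) ↥(A ⊓ perp B) + Module.finrank (ZMod 2) ↥(B ⊓ perp A) +
        2 * Module.finrank (ZMod 2) (Sectors A B) := by omega
  rw [h5, pow_add 2 (_ + _), ← mul_assoc, pow_mul] at h
  exact Nat.eq_of_mul_eq_mul_left (by positivity) h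

end Gauge

/-! ### From the generating set `G'` to labels -/

/-- The labels of the X-type operators in a finite set. -/
def xLabels (G' : Finset (Ops n)) : Finset (Bits n) :=
  G'.preimage xOp fun _ _ _ _ h => xOp_inj h

/-- The labels of the Z-type operators other than the identity in a finite set. -/
def zLabels (G' : Finset (Ops n)) : Finset (Bits n) :=
  (G'.preimage zOp fun _ _ _ _ h => zOp_inj h).erase 0

theorem mem_xLabels {G' : Finset (Ops n)} {a : Bits n} : a ∈ xLabels G' ↔ xOp a ∈ G' :=
  Finset.mem_preimage

theorem mem_zLabels {G' : Finset (Ops n)} {b : Bits n} :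
    b ∈ zLabels G' ↔ b ≠ 0 ∧ zOp b ∈ G' := by
  exact Finset.mem_erase.trans (and_congr_right fun _ => Finset.mem_preimage)

/-- The identity is the only operator of both types. It occurs at most once in `G'`, so it is
counted with the X-labels only. -/
theorem penaltyHamiltonian_eq {G' : Finset (Ops n)} (htype : ∀ g ∈ G', IsXType g ∨ IsZType g) :
    penaltyHamiltonian G' = cssHam (xLabels G') (zLabels G') := by
  classical
  have hunion : G' = (xLabels G').image xOp ∪ (zLabels G').image zOp := by
    ext g
    simp only [Finset.mem_union, Finset.mem_image, mem_xLabels, mem_zLabels]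
    constructor
    · intro hg
      rcases htype g hg with ⟨a, rfl⟩ | ⟨b, rfl⟩
      · exact Or.inl ⟨a, hg, rfl⟩
      · by_cases hb : b = 0
        · subst hb
          have h0 : (xOp 0 : Ops n) = zOp 0 := by rw [xOp_zero, zOp_zero]
          exact Or.inl ⟨0, h0 ▸ hg, h0⟩
        · exact Or.inr ⟨b, ⟨hb, hg⟩, rfl⟩
    · rintro (⟨a, ha, rfl⟩ | ⟨b, hb, rfl⟩)
      · exact ha
      · exact hb.2
  have hdisj : Disjoint ((xLabels G').image xOp) ((zLabels G').image zOp) := by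
    rw [Finset.disjoint_left]
    intro g h1 h2
    obtain ⟨a, -, rfl⟩ := Finset.mem_image.1 h1
    obtain ⟨b, hb, h⟩ := Finset.mem_image.1 h2
    exact (mem_zLabels.1 hb).1 (eq_zero_of_xOp_eq_zOp h.symm)
  rw [penaltyHamiltonian, cssHam]
  congr 1
  conv_lhs => rw [hunion]
  rw [Finset.sum_union hdisj, Finset.sum_image fun _ _ _ _ h => xOp_inj h,
    Finset.sum_image fun _ _ _ _ h => zOp_inj h]
  rfl

theorem xOp_mem_of_mem_span {K : Subgroup (Ops n)} {S : Set (Bits n)} (hS : ∀ a ∈ S, xOp a ∈ K)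
    {a : Bits n} (ha : a ∈ Submodule.span (ZMod 2) S) : xOp a ∈ K := by
  induction ha using Submodule.span_induction with
  | mem a ha => exact hS a ha
  | zero => rw [xOp_zero]; exact one_mem _
  | add a b _ _ iha ihb => rw [xOp_add]; exact mul_mem iha ihb
  | smul c a _ ih =>
    rcases eq_zero_or_eq_one c with rfl | rfl
    · rw [zero_smul, xOp_zero]; exact one_mem _
    · rwa [one_smul]

theorem zOp_mem_of_mem_span {K : Subgroup (Ops n)} {S : Set (Bits n)} (hS : ∀ b ∈ S, zOp b ∈ K)
    {b : Bits n} (hb : b ∈ Submodule.span (ZMod 2) S) : zOp b ∈ K := by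
  induction hb using Submodule.span_induction with
  | mem a ha => exact hS a ha
  | zero => rw [zOp_zero]; exact one_mem _
  | add a b _ _ iha ihb => rw [zOp_add]; exact mul_mem iha ihb
  | smul c a _ ih =>
    rcases eq_zero_or_eq_one c with rfl | rfl
    · rw [zero_smul, zOp_zero]; exact one_mem _
    · rwa [one_smul]

theorem le_pauliSubgroup_span {G : Subgroup (Ops n)} {G' : Finset (Ops n)}
    (htype : ∀ g ∈ G', IsXType g ∨ IsZType g)
    (hgen : G ≤ Subgroup.closure (G' : Set (Ops n)) ⊔ phases n) :
    G ≤ pauliSubgroup (Submodule.span (ZMod 2) (xLabels G' : Set (Bits n)))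
      (Submodule.span (ZMod 2) (zLabels G' : Set (Bits n))) := by
  refine hgen.trans (sup_le ((Subgroup.closure_le _).2 fun g hg => ?_)
    (phases_le_pauliSubgroup _ _))
  rcases htype g hg with ⟨a, rfl⟩ | ⟨b, rfl⟩
  · exact xOp_mem_pauliSubgroup _ (Submodule.subset_span (mem_xLabels.2 hg))
  · refine zOp_mem_pauliSubgroup _ ?_
    by_cases hb : b = 0
    · exact hb ▸ Submodule.zero_mem _
    · exact Submodule.subset_span (mem_zLabels.2 ⟨hb, hg⟩)

end SubsystemCode

end

theorem lemma1 (n : ℕ) (G : Subgroup (SubsystemCode.Ops n))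
    (G' : Finset (SubsystemCode.Ops n))
    (hsub : ∀ g ∈ G', g ∈ G)
    (htype : ∀ g ∈ G', SubsystemCode.IsXType g ∨ SubsystemCode.IsZType g)
    (hgen : G ≤ Subgroup.closure (G' : Set (SubsystemCode.Ops n)) ⊔ SubsystemCode.phases n) :
    (∀ s ∈ SubsystemCode.stabilizers G,
      ∀ ψ ∈ SubsystemCode.groundSpace (SubsystemCode.penaltyHamiltonian G'),
        SubsystemCode.toOperator s.val ψ = ψ) ∧
    (∃ k : ℕ, SubsystemCode.HasLogicalQubits G k ∧
      Module.finrank ℂ (SubsystemCode.groundSpace (SubsystemCode.penaltyHamiltonian G')) =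
        2 ^ k) ∧
    (∀ g ∈ G, ∃ c : ℂ,
      SubsystemCode.groundProjector (SubsystemCode.penaltyHamiltonian G') ∘L
          SubsystemCode.toOperator g.val ∘L
          SubsystemCode.groundProjector (SubsystemCode.penaltyHamiltonian G') =
        c • SubsystemCode.groundProjector (SubsystemCode.penaltyHamiltonian G')) := by
  open SubsystemCode in
  have hG := le_pauliSubgroup_span htype hgen
  rw [penaltyHamiltonian_eq htype]
  obtain ⟨A, hA⟩ : ∃ A, A = Submodule.span (ZMod 2) (xLabels G' : Set (Bits n)) := ⟨_, rfl⟩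
  obtain ⟨B, hB⟩ : ∃ B, B = Submodule.span (ZMod 2) (zLabels G' : Set (Bits n)) := ⟨_, rfl⟩
  rw [← hA, ← hB] at hG
  have hx : ∀ a ∈ A, xOp a ∈ G := fun a ha =>
    xOp_mem_of_mem_span (fun c hc => hsub _ (mem_xLabels.1 hc)) (hA ▸ ha)
  have hz : ∀ b ∈ B, zOp b ∈ G := fun b hb =>
    zOp_mem_of_mem_span (fun c hc => hsub _ (mem_zLabels.1 hc).2) (hB ▸ hb)
  refine ⟨?_, ⟨_, hasLogicalQubits hG hx hz, ?_⟩, ?_⟩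
  · rintro _ ⟨hs, a, b, rfl⟩ ψ hψ
    -- The representative X(a)Z(b) carries the trivial phase, inserted here to match the normal
    -- form.
    rw [stabilizersWithPhases_eq hG hx hz, ← one_mul (xOp a * zOp b)] at hs
    obtain ⟨ha, hb⟩ := mem_of_mul_mem_pauliSubgroup (one_mem _) hs
    rw [hA, hB] at ha hb
    rw [toOperator_mul, toOperator_zOp, toOperator_xOp, zPhase_eq_self hb.1 hb.2 hψ,
      xShift_eq_self ha.1 ha.2 hψ]
  · rw [finrank_groundSpace hA hB, Module.natCard_eq_pow_finrank (K := ZMod 2), Nat.card_zmod]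
  · intro g hg
    -- The phase of g is absorbed into the final scalar.
    obtain ⟨p, hp, a, ha, b, hb, rfl⟩ := hG hg
    obtain ⟨u, rfl⟩ := exists_scalarOp_eq hp
    obtain ⟨c, hc⟩ := exists_scalar_inner hA hB ha hb
    refine ⟨u * c, exists_scalar_projector fun f hf g hg => ?_⟩
    rw [toOperator_mul, toOperator_mul, toOperator_scalarOp, toOperator_xOp, toOperator_zOp,
      inner_smul_right, hc f hf g hg, mul_assoc]
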